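/- Let $d\ge 1$, $I_\pm=\{\pm1,\dots,\pm d\}$, and let $r:I_\pm\to\mathbb Z^d$ be any function. For a permutation $\pi$ of $I_\pm$ and phases $\Theta=(\theta_\tau)_{\tau\in I_\pm}$ let $C(\pi,\Theta)$ be the unitary $2d\times 2d$ matrix with entries $C_{\sigma\tau}(\pi,\Theta)=e^{i\theta_\sigma}\delta_{\sigma,\pi(\tau)}$. Let $C_k=C(\pi_k,\Theta_k)$, $k=1,2,\dots$, be independent, identically distributed random matrices of this form on a probability space, let $\mu(\pi)$ be the probability that $C_1=C(\pi,\Theta)$ for some $\Theta$, and let $$P(\sigma',\sigma)=\sum_{\pi}\mu(\pi)\,\delta_{\sigma,\pi(\sigma')},\qquad \sigma',\sigma\in I_\pm .$$ Assume that the stochastic matrix $P$ is irreducible, i.e. for all $\sigma,\tau$ there is $n\ge1$ with $P^n(\sigma,\tau)>0$. For $\sigma\in I_\pm$ let $\mathbb P_\sigma$ denote the law of the Markov chain $\tau_0=\sigma$, $\tau_j=\pi_j(\tau_{j-1})$ $(j\ge1)$, and let $Z_n=\frac1n\sum_{j=1}^n r(\tau_j)\in\mathbb R^d$. For $\lambda\in\mathbb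 R^d$ let $\Pi_\lambda(\sigma,\tau)=P(\sigma,\tau)e^{\langle\lambda, r(\tau)\rangle}$. Then $\Pi_\lambda$ has a largest real eigenvalue $\rho(\lambda)$ (its Perron–Frobenius eigenvalue), and $\rho(\lambda)>0$. The function $$I(x)=\sup_{\lambda\in\mathbb R^d}\bigl(\langle\lambda,x\rangle-\ln\rho(\lambda)\bigr)\in[0,\infty],\qquad x\in\mathbb R^d,$$ is a convex good rate function (convex, non-negative, lower semicontinuous, with compact sublevel sets $\{I\le a\}$, $a\in\mathbb R$), and for every $\sigma\in I_\pm$ and every $\Gamma\subset\mathbb R^d$, with interior $\Gamma^0$ and closure $\overline\Gamma$, $$-\inf_{x\in\Gamma^0}I(x)\le\liminf_{n\to\infty}\frac1n\ln\mathbb P_\sigma(Z_n\in\Gamma)\le\limsup_{n\to\infty}\frac1n\ln\mathbb P_\sigma(Z_n\in\Gamma)\le-\inf_{x\in\overline\Gamma}I(x),$$ where $\ln0=-\infty$ and $\inf\emptyset=+\infty$. -/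

import Mathlib

open MeasureTheory ProbabilityTheory Filter

noncomputable section

/-- The index set `I_± = {±1, ±2, …, ±d}` of the coin states. -/
abbrev CoinIndex (d : ℕ) : Type := ↥((Finset.Icc (-(d : ℤ)) (d : ℤ)).erase 0)

/-- The entrywise (equivalently Borel) σ-algebra on the complex matrices indexed by `I_±`. -/
instance coinMeasurableSpace (d : ℕ) :
    MeasurableSpace (Matrix (CoinIndex d) (CoinIndex d) ℂ) := MeasurableSpace.pi

/-- The permutation coin with phases,
`C(π, Θ) = ∑_τ e^{i θ_{π(τ)}} |π(τ)⟩⟨τ|`, i.e. `C_{σ τ} = e^{i θ_σ} δ_{σ, π(τ)}`. -/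
def coinMatrix {d : ℕ} (p : Equiv.Perm (CoinIndex d)) (θ : CoinIndex d → ℝ) :
    Matrix (CoinIndex d) (CoinIndex d) ℂ :=
  fun σ τ => if σ = p τ then Complex.exp (Complex.I * (θ σ : ℂ)) else 0

/-- The law `μ(π)` on permutations induced by a random coin matrix `C`: the probability that
`C` is of the form `C(π, Θ)` for some phases `Θ`. -/
def permLaw {d : ℕ} {Ω : Type*} [MeasurableSpace Ω] (ν : Measure Ω)
    (C : Ω → Matrix (CoinIndex d) (CoinIndex d) ℂ) (p : Equiv.Perm (CoinIndex d)) : ℝ :=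
  ν.real {ω | ∃ θ : CoinIndex d → ℝ, C ω = coinMatrix p θ}

/-- The transition matrix `P(σ', σ) = ∑_π μ(π) δ_{σ, π(σ')}`, where `μ` is the law on
permutations induced by the random coin `C`. -/
def transitionMatrix {d : ℕ} {Ω : Type*} [MeasurableSpace Ω] (ν : Measure Ω)
    (C : Ω → Matrix (CoinIndex d) (CoinIndex d) ℂ) :
    Matrix (CoinIndex d) (CoinIndex d) ℝ :=
  fun σ' σ => ∑ p : Equiv.Perm (CoinIndex d), permLaw ν C p * (if σ = p σ' then 1 else 0)

/-- The path `τ_0 = σ`, `τ_{j+1} = π_{j+1}(τ_j)`; the permutation `π_{j+1}` of step `j + 1`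
is the entry `π j` of the sequence. -/
def coinPath {d : ℕ} (π : ℕ → Equiv.Perm (CoinIndex d)) (σ : CoinIndex d) : ℕ → CoinIndex d
  | 0 => σ
  | j + 1 => π j (coinPath π σ j)

/-- The value `r(τ) ∈ ℤ^d` of a jump function, seen as a vector of Euclidean space `ℝ^d`. -/
def jumpVec {d : ℕ} (r : CoinIndex d → Fin d → ℤ) (τ : CoinIndex d) :
    EuclideanSpace ℝ (Fin d) :=
  WithLp.toLp 2 (fun i => (r τ i : ℝ))

/-- The empirical mean `Z_n = (1/n) ∑_{j=1}^n r(τ_j)` along the path started at `σ`. -/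
def meanJump {d : ℕ} (r : CoinIndex d → Fin d → ℤ) (π : ℕ → Equiv.Perm (CoinIndex d))
    (σ : CoinIndex d) (n : ℕ) : EuclideanSpace ℝ (Fin d) :=
  (n : ℝ)⁻¹ • ∑ j ∈ Finset.Icc 1 n, jumpVec r (coinPath π σ j)

/-- The tilted matrix `Π_l(σ, τ) = P(σ, τ) e^{⟨l, r(τ)⟩}`. -/
def tiltedMatrix {d : ℕ} (P : Matrix (CoinIndex d) (CoinIndex d) ℝ)
    (r : CoinIndex d → Fin d → ℤ) (l : EuclideanSpace ℝ (Fin d)) :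
    Matrix (CoinIndex d) (CoinIndex d) ℝ :=
  fun σ τ => P σ τ * Real.exp (inner ℝ l (jumpVec r τ))

/-- The set of real eigenvalues of a real square matrix. -/
def realEigenvalues {ι : Type*} [Fintype ι] [DecidableEq ι] (A : Matrix ι ι ℝ) : Set ℝ :=
  {t | Module.End.HasEigenvalue (Matrix.toLin' A) t}

/-- The Perron–Frobenius eigenvalue: the largest real eigenvalue. -/
def perronEigenvalue {ι : Type*} [Fintype ι] [DecidableEq ι] (A : Matrix ι ι ℝ) : ℝ :=
  sSup (realEigenvalues A)

/-- `I(x) = sup_l (⟨l, x⟩ - ln ρ(l))`, with values in the extended reals, where `ρ(l)` is the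
Perron–Frobenius eigenvalue of the tilted matrix. -/
def rateFunction {d : ℕ} (P : Matrix (CoinIndex d) (CoinIndex d) ℝ)
    (r : CoinIndex d → Fin d → ℤ) (x : EuclideanSpace ℝ (Fin d)) : EReal :=
  ⨆ l : EuclideanSpace ℝ (Fin d),
    ((inner ℝ l x - Real.log (perronEigenvalue (tiltedMatrix P r l)) : ℝ) : EReal)

/-- A good rate function: `[0, ∞]`-valued, lower semicontinuous, with compact sublevel sets. -/
structure IsGoodRateFunction {E : Type*} [TopologicalSpace E] (I : E → EReal) : Prop where
  nonneg : ∀ x, 0 ≤ I x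
  lsc : LowerSemicontinuous I
  compact_sublevel : ∀ a : ℝ, IsCompact {x | I x ≤ (a : EReal)}

/-- Convexity of an extended real valued function (used for nonnegative functions only). -/
def IsConvexEReal {E : Type*} [AddCommGroup E] [Module ℝ E] (I : E → EReal) : Prop :=
  ∀ x y : E, ∀ a b : ℝ, 0 ≤ a → 0 ≤ b → a + b = 1 →
    I (a • x + b • y) ≤ (a : EReal) * I x + (b : EReal) * I y

/-- The large deviation bounds with speed `n` and rate function `I`, for all sets `Γ`, of a
sequence of random elements `Z n` of `E`; here `ln 0 = -∞` and `inf ∅ = +∞`. -/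
def LargeDeviationBounds {Ω E : Type*} [MeasurableSpace Ω] [TopologicalSpace E]
    (ν : Measure Ω) (Z : ℕ → Ω → E) (I : E → EReal) : Prop :=
  ∀ Γ : Set E,
    -(⨅ x ∈ interior Γ, I x) ≤
        liminf (fun n : ℕ => ENNReal.log (ν {ω | Z n ω ∈ Γ}) / (n : EReal)) atTop ∧
    liminf (fun n : ℕ => ENNReal.log (ν {ω | Z n ω ∈ Γ}) / (n : EReal)) atTop ≤
        limsup (fun n : ℕ => ENNReal.log (ν {ω | Z n ω ∈ Γ}) / (n : EReal)) atTop ∧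
    limsup (fun n : ℕ => ENNReal.log (ν {ω | Z n ω ∈ Γ}) / (n : EReal)) atTop ≤
        -(⨅ x ∈ closure Γ, I x)

end

/-! Path weights, summed over the total jump with the tilt `l`, are the entries of powers of the
tilted matrix (`hasSum_pathWeight`), so their growth is governed by its Perron eigenvalue ρ(l). The
Perron–Frobenius facts come from maximizing the Collatz–Wielandt ratio.

Upper bound: a Chernoff estimate controls each half-space {⟨l,x⟩ − ln ρ(l) > b}
(`exists_measureReal_halfSpace_le`). Jumps are bounded, so Z_n stays in a fixed ball, and finitely
many such half-spaces cover the relevant part of the closure of Γ.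

Lower bound, without differentiability of ln ρ: record each loop class at σ by its mean jump and a
rate below its exponential weight. Concatenation makes the closure of this set convex
(`convex_closure_loopSet`). At a given length only polynomially many total jumps occur, so by
pigeonhole its support function in direction (l,1) is at least ln ρ(l)
(`exists_loopSet_log_perron_le`). Hahn–Banach separation then puts (x,−a) in the closure as soon as
a bounds ⟨l,x⟩ − ln ρ(l) for all l (`mem_closure_of_forall_inner_sub_le`). Repeating a nearly
optimal loop, with a remainder of bounded length, yields the bound on probabilities
(`eventually_le_measureReal_of_mem_loopSet`). -/

/-! ### Perron–Frobenius theory for irreducible matrices. -/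

section PerronFrobenius

variable {ι : Type*} [Fintype ι]

lemma exists_pos_mul_le (f g : ι → ℝ) (hf : ∀ i, 0 < f i) (hg : ∀ i, 0 < g i) :
    ∃ ε > 0, ∀ i, ε * g i ≤ f i := by
  rcases isEmpty_or_nonempty ι with h | h
  · exact ⟨1, one_pos, fun i => (h.false i).elim⟩
  obtain ⟨i₀, -, h₀⟩ := Finset.exists_min_image Finset.univ (fun i => f i / g i)
    Finset.univ_nonempty
  refine ⟨f i₀ / g i₀, div_pos (hf _) (hg _), fun i => ?_⟩
  exact (le_div_iff₀ (hg i)).1 (h₀ i (Finset.mem_univ i))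

lemma mulVec_apply_pos {A : Matrix ι ι ℝ} (hA : ∀ i j, 0 < A i j) {x : ι → ℝ}
    (hx : ∀ i, 0 ≤ x i) (hx0 : x ≠ 0) (i : ι) : 0 < A.mulVec x i := by
  obtain ⟨j, hj⟩ := Function.ne_iff.1 hx0
  exact Finset.sum_pos' (fun j _ => mul_nonneg (hA i j).le (hx j))
    ⟨j, Finset.mem_univ j, mul_pos (hA i j) (lt_of_le_of_ne (hx j) (Ne.symm hj))⟩

/-- The maximal Collatz–Wielandt ratio of a nonnegative matrix is attained. -/
lemma exists_max_subeigenvalue [Nonempty ι] {A : Matrix ι ι ℝ} (hA : ∀ i j, 0 ≤ A i j) :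
    ∃ ρ : ℝ, 0 ≤ ρ ∧ (∃ x : ι → ℝ, (∀ i, 0 ≤ x i) ∧ x ≠ 0 ∧ ∀ i, ρ * x i ≤ A.mulVec x i) ∧
      ∀ (t : ℝ) (y : ι → ℝ), (∀ i, 0 ≤ y i) → y ≠ 0 → (∀ i, t * y i ≤ A.mulVec y i) → t ≤ ρ := by
  classical
  -- The sum of all entries bounds every ratio attained on the simplex, so the search region is
  -- compact.
  set M : ℝ := ∑ i, ∑ j, A i j with hM
  have hM0 : 0 ≤ M := Finset.sum_nonneg fun i _ => Finset.sum_nonneg fun j _ => hA i j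
  set K : Set (ℝ × (ι → ℝ)) := Set.Icc 0 M ×ˢ stdSimplex ℝ ι with hK
  have hKc : IsCompact K := isCompact_Icc.prod (isCompact_stdSimplex ℝ ι)
  set T : Set (ℝ × (ι → ℝ)) := K ∩ {p | ∀ i, p.1 * p.2 i ≤ A.mulVec p.2 i} with hT
  have hTc : IsCompact T := by
    refine hKc.inter_right ?_
    simp only [Set.ofPred_forall]
    refine isClosed_iInter fun i => isClosed_le (by fun_prop) ?_
    simp only [Matrix.mulVec, dotProduct]
    fun_prop
  have hne : T.Nonempty := by
    obtain ⟨i₀⟩ := ‹Nonempty ι›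
    refine ⟨(0, Pi.single i₀ 1), ⟨⟨le_rfl, hM0⟩, single_mem_stdSimplex ℝ i₀⟩, fun i => ?_⟩
    simpa using hA i i₀
  obtain ⟨⟨ρ, x⟩, ⟨⟨hρ, hx⟩, hxA⟩, hmax⟩ := hTc.exists_isMaxOn hne continuous_fst.continuousOn
  refine ⟨ρ, hρ.1, ⟨x, hx.1, ?_, hxA⟩, fun t y hy hy0 hty => ?_⟩
  · rintro rfl
    simpa using hx.2
  rcases le_or_gt t 0 with ht | ht
  · exact ht.trans hρ.1
  set s : ℝ := ∑ i, y i with hs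
  have hs0 : 0 < s := by
    obtain ⟨j, hj⟩ := Function.ne_iff.1 hy0
    exact Finset.sum_pos' (fun j _ => hy j)
      ⟨j, Finset.mem_univ j, lt_of_le_of_ne (hy j) (Ne.symm hj)⟩
  have hyS : s⁻¹ • y ∈ stdSimplex ℝ ι := by
    refine ⟨fun i => mul_nonneg (inv_nonneg.2 hs0.le) (hy i), ?_⟩
    simp only [Pi.smul_apply, smul_eq_mul, ← Finset.mul_sum]
    exact inv_mul_cancel₀ hs0.ne'
  have hyA : ∀ i, t * (s⁻¹ • y) i ≤ A.mulVec (s⁻¹ • y) i := by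
    intro i
    rw [Matrix.mulVec_smul]
    simp only [Pi.smul_apply, smul_eq_mul]
    calc t * (s⁻¹ * y i) = s⁻¹ * (t * y i) := by ring
      _ ≤ _ := mul_le_mul_of_nonneg_left (hty i) (inv_nonneg.2 hs0.le)
  have htM : t ≤ M := by
    calc t = ∑ i, t * (s⁻¹ • y) i := by rw [← Finset.mul_sum, hyS.2, mul_one]
      _ ≤ ∑ i, A.mulVec (s⁻¹ • y) i := Finset.sum_le_sum fun i _ => hyA i
      _ ≤ M := Finset.sum_le_sum fun i _ => Finset.sum_le_sum fun j _ => by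
          refine mul_le_of_le_one_right (hA i j) ?_
          rw [← hyS.2]
          exact Finset.single_le_sum (fun k _ => hyS.1 k) (Finset.mem_univ j)
  exact hmax (show ((t, s⁻¹ • y) : ℝ × (ι → ℝ)) ∈ T from ⟨⟨⟨ht.le, htM⟩, hyS⟩, hyA⟩)

variable [DecidableEq ι]

lemma pow_mulVec_of_mulVec_eq {A : Matrix ι ι ℝ} {ρ : ℝ} {x : ι → ℝ}
    (h : A.mulVec x = ρ • x) (k : ℕ) : (A ^ k).mulVec x = ρ ^ k • x := by
  induction k with
  | zero => simp
  | succ k ih => rw [pow_succ, ← Matrix.mulVec_mulVec, h, Matrix.mulVec_smul, ih, smul_smul,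
      pow_succ, mul_comm]

/-- Perron–Frobenius: existence of a positive eigenvector for an irreducible matrix. -/
theorem Matrix.IsIrreducible.exists_pos_eigenvector [Nonempty ι] {A : Matrix ι ι ℝ}
    (hA : A.IsIrreducible) :
    ∃ ρ : ℝ, 0 < ρ ∧ (∃ h : ι → ℝ, (∀ i, 0 < h i) ∧ A.mulVec h = ρ • h) ∧
      ∀ (t : ℝ) (y : ι → ℝ), y ≠ 0 → A.mulVec y = t • y → t ≤ ρ := by
  have hirr := (Matrix.isIrreducible_iff_exists_pow_pos hA.nonneg).1 hA
  obtain ⟨ρ, hρ, ⟨x, hx, hx0, hxA⟩, hmax⟩ := exists_max_subeigenvalue hA.nonneg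
  choose k hk0 hk using hirr
  -- A finite sum of powers is entrywise positive even when the matrix is periodic, and it commutes
  -- with `A`.
  set N : ℕ := (Finset.univ.sup fun p : ι × ι => k p.1 p.2) + 1 with hN
  set B : Matrix ι ι ℝ := ∑ n ∈ Finset.range N, A ^ n with hB
  have hBpos : ∀ i j, 0 < B i j := by
    intro i j
    rw [hB, Matrix.sum_apply]
    refine Finset.sum_pos' (fun n _ => Matrix.pow_apply_nonneg hA.nonneg n i j)
      ⟨k i j, Finset.mem_range.2 (Nat.lt_succ_of_le ?_), hk i j⟩
    exact Finset.le_sup (f := fun p : ι × ι => k p.1 p.2) (Finset.mem_univ (i, j))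
  have hcomm : A * B = B * A := by
    rw [hB, Finset.mul_sum, Finset.sum_mul]
    exact Finset.sum_congr rfl fun n _ => by rw [← pow_succ, ← pow_succ']
  have hBx : ∀ i, 0 < B.mulVec x i := mulVec_apply_pos hBpos hx hx0
  -- A nonzero defect `z` becomes strictly positive under `B`, so `B x` would have a ratio exceeding
  -- the maximal `ρ`.
  have heig : A.mulVec x = ρ • x := by
    by_contra hne
    set z : ι → ℝ := A.mulVec x - ρ • x with hz
    have hBz : ∀ i, 0 < B.mulVec z i :=
      mulVec_apply_pos hBpos (fun i => by simpa [hz] using hxA i) (sub_ne_zero.2 hne)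
    obtain ⟨ε, hε, hle⟩ := exists_pos_mul_le _ _ hBz hBx
    have : ρ + ε ≤ ρ := by
      refine hmax _ (B.mulVec x) (fun i => (hBx i).le) ?_ fun i => ?_
      · obtain ⟨i⟩ := ‹Nonempty ι›
        exact fun h0 => (hBx i).ne' (congrFun h0 i)
      · have h1 : A.mulVec (B.mulVec x) = B.mulVec z + ρ • B.mulVec x := by
          rw [Matrix.mulVec_mulVec, hcomm, ← Matrix.mulVec_mulVec, ← Matrix.mulVec_smul,
            ← Matrix.mulVec_add, hz, sub_add_cancel]
        have h2 := congrFun h1 i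
        simp only [Pi.add_apply, Pi.smul_apply, smul_eq_mul] at h2
        rw [h2]
        linarith [hle i]
    linarith
  have hxpos : ∀ i, 0 < x i := by
    intro i
    have h1 : B.mulVec x = (∑ n ∈ Finset.range N, ρ ^ n) • x := by
      rw [hB, Matrix.sum_mulVec, Finset.sum_smul]
      exact Finset.sum_congr rfl fun n _ => pow_mulVec_of_mulVec_eq heig n
    have h2 := hBx i
    rw [h1] at h2
    exact lt_of_le_of_ne (hx i) fun h0 => by simp [← h0] at h2
  refine ⟨ρ, lt_of_le_of_ne hρ ?_, ⟨x, hxpos, heig⟩, fun t y hy0 hty => ?_⟩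
  · rintro rfl
    obtain ⟨i⟩ := ‹Nonempty ι›
    have h1 := congrFun (pow_mulVec_of_mulVec_eq heig (k i i)) i
    have h2 : 0 < (A ^ k i i).mulVec x i :=
      Finset.sum_pos' (fun j _ => mul_nonneg (Matrix.pow_apply_nonneg hA.nonneg _ i j) (hx j))
        ⟨i, Finset.mem_univ i, mul_pos (hk i i) (hxpos i)⟩
    rw [h1, zero_pow (hk0 i i).ne'] at h2
    simp at h2
  -- By the triangle inequality, |y| is a nonnegative test vector with ratio |t|.
  · refine (le_abs_self t).trans (hmax _ (fun i => |y i|) (fun i => abs_nonneg _) ?_ fun i => ?_)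
    · intro h0
      exact hy0 (funext fun i => abs_eq_zero.1 (congrFun h0 i))
    · have h1 := congrFun hty i
      simp only [Pi.smul_apply, smul_eq_mul] at h1
      rw [← abs_mul, ← h1]
      refine (Finset.abs_sum_le_sum_abs _ _).trans (Finset.sum_le_sum fun j _ => ?_)
      rw [abs_mul, abs_of_nonneg (hA.nonneg i j)]

lemma hasEigenvalue_toLin'_iff {A : Matrix ι ι ℝ} {t : ℝ} :
    t ∈ realEigenvalues A ↔ ∃ y : ι → ℝ, y ≠ 0 ∧ A.mulVec y = t • y := by
  constructor
  · intro h
    obtain ⟨y, hy⟩ := Module.End.HasEigenvalue.exists_hasEigenvector h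
    exact ⟨y, hy.2, by simpa using hy.apply_eq_smul⟩
  · rintro ⟨y, hy0, hy⟩
    exact Module.End.hasEigenvalue_of_hasEigenvector
      (x := y) ⟨Module.End.mem_eigenspace_iff.2 (by simpa using hy), hy0⟩

/-- The supremum defining `perronEigenvalue` is attained at the Collatz–Wielandt maximum, so it is a
genuine eigenvalue and not a default value of `sSup`. -/
theorem Matrix.IsIrreducible.perronEigenvalue_spec [Nonempty ι] {A : Matrix ι ι ℝ}
    (hA : A.IsIrreducible) :
    0 < perronEigenvalue A ∧ IsGreatest (realEigenvalues A) (perronEigenvalue A) ∧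
      ∃ h : ι → ℝ, (∀ i, 0 < h i) ∧ A.mulVec h = perronEigenvalue A • h := by
  obtain ⟨ρ, hρ, ⟨h, hh, hAh⟩, hmax⟩ := hA.exists_pos_eigenvector
  have hg : IsGreatest (realEigenvalues A) ρ := by
    refine ⟨hasEigenvalue_toLin'_iff.2 ⟨h, ?_, hAh⟩, fun t ht => ?_⟩
    · obtain ⟨i⟩ := ‹Nonempty ι›
      exact fun h0 => (hh i).ne' (congrFun h0 i)
    · obtain ⟨y, hy0, hy⟩ := hasEigenvalue_toLin'_iff.1 ht
      exact hmax t y hy0 hy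
  have he : perronEigenvalue A = ρ := hg.csSup_eq
  rw [he]
  exact ⟨hρ, hg, h, hh, hAh⟩

/-- Evaluate the eigenvector equation at a largest entry of the positive eigenvector. -/
lemma perronEigenvalue_le_of_sum_le [Nonempty ι] {A : Matrix ι ι ℝ} (hA : A.IsIrreducible)
    {c : ℝ} (hc : ∀ i, ∑ j, A i j ≤ c) : perronEigenvalue A ≤ c := by
  obtain ⟨-, -, h, hh, hAh⟩ := hA.perronEigenvalue_spec
  obtain ⟨i, -, hi⟩ := Finset.exists_max_image Finset.univ h Finset.univ_nonempty
  have h1 := congrFun hAh i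
  simp only [Pi.smul_apply, smul_eq_mul] at h1
  refine le_of_mul_le_mul_right ?_ (hh i)
  rw [← h1]
  calc A.mulVec h i ≤ ∑ j, A i j * h i :=
        Finset.sum_le_sum fun j _ => mul_le_mul_of_nonneg_left (hi j (Finset.mem_univ j))
          (hA.nonneg i j)
    _ = (∑ j, A i j) * h i := by rw [Finset.sum_mul]
    _ ≤ c * h i := mul_le_mul_of_nonneg_right (hc i) (hh i).le

/-- The row sums of the powers grow at most like the powers of the Perron eigenvalue. -/
lemma exists_sum_pow_le [Nonempty ι] {A : Matrix ι ι ℝ} (hA : A.IsIrreducible) :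
    ∃ K > 0, ∀ (n : ℕ) (i : ι), ∑ j, (A ^ n) i j ≤ K * perronEigenvalue A ^ n := by
  obtain ⟨hρ, -, h, hh, hAh⟩ := hA.perronEigenvalue_spec
  obtain ⟨ε, hε, hle⟩ := exists_pos_mul_le h (fun _ => 1) hh fun _ => one_pos
  obtain ⟨δ, hδ, hge⟩ := exists_pos_mul_le (fun _ : ι => 1) h (fun _ => one_pos) hh
  refine ⟨ε⁻¹ * δ⁻¹, by positivity, fun n i => ?_⟩
  have h1 := congrFun (pow_mulVec_of_mulVec_eq hAh n) i
  simp only [Pi.smul_apply, smul_eq_mul] at h1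
  have h2 : ε * ∑ j, (A ^ n) i j ≤ (A ^ n).mulVec h i := by
    rw [Finset.mul_sum]
    refine Finset.sum_le_sum fun j _ => ?_
    rw [mul_comm]
    exact mul_le_mul_of_nonneg_left (by simpa using hle j)
      (Matrix.pow_apply_nonneg hA.nonneg n i j)
  have h3 : h i ≤ δ⁻¹ := by
    rw [← one_div, le_div_iff₀ hδ, mul_comm]
    exact hge i
  rw [h1] at h2
  have h4 : perronEigenvalue A ^ n * h i ≤ perronEigenvalue A ^ n * δ⁻¹ :=
    mul_le_mul_of_nonneg_left h3 (by positivity)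
  calc ∑ j, (A ^ n) i j = ε⁻¹ * (ε * ∑ j, (A ^ n) i j) := by field_simp
    _ ≤ ε⁻¹ * (perronEigenvalue A ^ n * δ⁻¹) :=
        mul_le_mul_of_nonneg_left (h2.trans h4) (by positivity)
    _ = _ := by ring

/-- The return weights grow, along a subsequence, like the powers of the Perron eigenvalue. -/
lemma exists_le_pow_apply_self [Nonempty ι] {A : Matrix ι ι ℝ} (hA : A.IsIrreducible) (i : ι) :
    ∃ c > 0, ∀ n : ℕ, ∃ m ≥ n, c * perronEigenvalue A ^ m ≤ (A ^ m) i i := by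
  obtain ⟨hρ, -, h, hh, hAh⟩ := hA.perronEigenvalue_spec
  set ρ := perronEigenvalue A
  choose k hk0 hk using (Matrix.isIrreducible_iff_exists_pow_pos hA.nonneg).1 hA
  have hcard : (0 : ℝ) < Fintype.card ι := by exact_mod_cast Fintype.card_pos
  -- `c` is uniform over the finitely many intermediate states `j`: it pays for the average share at
  -- `j` and for closing the loop from `j` to `i`.
  obtain ⟨c, hc, hle⟩ := exists_pos_mul_le
    (fun j => h i / (Fintype.card ι * h j) * (A ^ k j i) j i) (fun j => ρ ^ k j i)
    (fun j => mul_pos (div_pos (hh i) (mul_pos hcard (hh j))) (hk j i)) (fun j => by positivity)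
  refine ⟨c, hc, fun n => ?_⟩
  have h1 := congrFun (pow_mulVec_of_mulVec_eq hAh n) i
  simp only [Pi.smul_apply, smul_eq_mul] at h1
  -- Some term of the sum `(A ^ n) h` at `i` is at least the average; `k j i` further steps lead
  -- back to `i`.
  obtain ⟨j, hj⟩ : ∃ j, ρ ^ n * h i / Fintype.card ι ≤ (A ^ n) i j * h j := by
    by_contra! hcon
    have h2 : (A ^ n).mulVec h i < ∑ _j : ι, ρ ^ n * h i / Fintype.card ι :=
      Finset.sum_lt_sum_of_nonempty Finset.univ_nonempty fun j _ => hcon j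
    rw [h1, Finset.sum_const, Finset.card_univ, nsmul_eq_mul, mul_div_cancel₀ _ hcard.ne'] at h2
    exact lt_irrefl _ h2
  refine ⟨n + k j i, Nat.le_add_right _ _, ?_⟩
  have h3 : (A ^ n) i j * (A ^ k j i) j i ≤ (A ^ (n + k j i)) i i := by
    rw [pow_add, Matrix.mul_apply]
    exact Finset.single_le_sum (f := fun l => (A ^ n) i l * (A ^ k j i) l i)
      (fun l _ => mul_nonneg (Matrix.pow_apply_nonneg hA.nonneg _ _ _)
      (Matrix.pow_apply_nonneg hA.nonneg _ _ _)) (Finset.mem_univ j)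
  have h4 : ρ ^ n * (h i / (Fintype.card ι * h j)) ≤ (A ^ n) i j := by
    rw [← div_le_iff₀ (hh j)] at hj
    refine le_trans (le_of_eq ?_) hj
    field_simp
  calc c * ρ ^ (n + k j i) = ρ ^ n * (c * ρ ^ k j i) := by ring
    _ ≤ ρ ^ n * (h i / (Fintype.card ι * h j) * (A ^ k j i) j i) :=
        mul_le_mul_of_nonneg_left (hle j) (by positivity)
    _ = ρ ^ n * (h i / (Fintype.card ι * h j)) * (A ^ k j i) j i := by ring
    _ ≤ (A ^ n) i j * (A ^ k j i) j i := mul_le_mul_of_nonneg_right h4 (hk j i).le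
    _ ≤ _ := h3

end PerronFrobenius

/-! ### Weights of paths with prescribed total jump. -/

section PathWeight

/-- A lattice vector seen in Euclidean space. -/
noncomputable def latticeVec {d : ℕ} (v : Fin d → ℤ) : EuclideanSpace ℝ (Fin d) :=
  WithLp.toLp 2 (fun i => (v i : ℝ))

variable {d : ℕ}

lemma latticeVec_zero : latticeVec (0 : Fin d → ℤ) = 0 := by
  ext i; simp [latticeVec]

lemma latticeVec_add (u v : Fin d → ℤ) : latticeVec (u + v) = latticeVec u + latticeVec v := by
  ext i; simp [latticeVec]

lemma latticeVec_nsmul (k : ℕ) (v : Fin d → ℤ) : latticeVec (k • v) = (k : ℝ) • latticeVec v := by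
  ext i; simp [latticeVec]

/-- The total weight of the paths of length `n` from `σ` to `τ` along which the jumps sum up
to `v`. -/
noncomputable def pathWeight (P : Matrix (CoinIndex d) (CoinIndex d) ℝ)
    (r : CoinIndex d → Fin d → ℤ) :
    ℕ → CoinIndex d → CoinIndex d → (Fin d → ℤ) → ℝ
  | 0, σ, τ, v => if σ = τ ∧ v = 0 then 1 else 0
  | n + 1, σ, τ, v => ∑ κ, pathWeight P r n σ κ (v - r τ) * P κ τ

variable {P : Matrix (CoinIndex d) (CoinIndex d) ℝ} {r : CoinIndex d → Fin d → ℤ}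

lemma pathWeight_nonneg (hP : ∀ σ τ, 0 ≤ P σ τ) (n : ℕ) (σ τ : CoinIndex d) (v : Fin d → ℤ) :
    0 ≤ pathWeight P r n σ τ v := by
  induction n generalizing τ v with
  | zero => simp only [pathWeight]; split_ifs <;> simp
  | succ n ih => exact Finset.sum_nonneg fun κ _ => mul_nonneg (ih κ _) (hP κ τ)

lemma abs_le_of_pathWeight_ne_zero {R : ℕ} (hR : ∀ τ i, |r τ i| ≤ R) (n : ℕ)
    (σ τ : CoinIndex d) (v : Fin d → ℤ) (h : pathWeight P r n σ τ v ≠ 0) (i : Fin d) :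
    |v i| ≤ n * R := by
  induction n generalizing τ v with
  | zero =>
    have : v = 0 := by
      by_contra hv
      simp [pathWeight, hv] at h
    simp [this]
  | succ n ih =>
    obtain ⟨κ, -, hκ⟩ := Finset.exists_ne_zero_of_sum_ne_zero h
    have h1 := ih κ _ (left_ne_zero_of_mul hκ)
    have h2 := hR τ i
    simp only [Pi.sub_apply] at h1
    rw [abs_le] at *
    push_cast
    constructor <;> nlinarith

/-- The tilt is multiplicative along a path, so the exponential generating function of the weights
obeys the recursion of matrix powers. -/
lemma hasSum_pathWeight (l : EuclideanSpace ℝ (Fin d)) (n : ℕ) (σ τ : CoinIndex d) :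
    HasSum (fun v => pathWeight P r n σ τ v * Real.exp (inner ℝ l (latticeVec v)))
      ((tiltedMatrix P r l ^ n) σ τ) := by
  induction n generalizing τ with
  | zero =>
    have h := hasSum_ite_eq (0 : Fin d → ℤ) (if σ = τ then (1 : ℝ) else 0)
    rw [pow_zero, Matrix.one_apply]
    convert h using 2 with v
    by_cases hv : v = 0
    · simp [pathWeight, hv, latticeVec_zero]
    · simp [pathWeight, hv]
  | succ n ih =>
    rw [pow_succ, Matrix.mul_apply]
    simp only [pathWeight, Finset.sum_mul]
    refine hasSum_sum fun κ _ => ?_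
    have h := (ih κ).mul_right (tiltedMatrix P r l κ τ)
    -- Shift the summation variable by the last jump.
    rw [← (Equiv.subRight (r τ)).hasSum_iff] at h
    refine h.congr_fun ?_
    intro v
    have h1 : latticeVec v = latticeVec (v - r τ) + jumpVec r τ := by
      rw [show jumpVec r τ = latticeVec (r τ) from rfl, ← latticeVec_add, sub_add_cancel]
    simp only [Function.comp_apply, Equiv.subRight_apply, tiltedMatrix]
    rw [h1, inner_add_right, Real.exp_add]
    ring

lemma tiltedMatrix_zero : tiltedMatrix P r 0 = P := by
  ext σ τ; simp [tiltedMatrix]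

lemma pathWeight_le_one (hP : ∀ σ τ, 0 ≤ P σ τ) (hP1 : ∀ σ, ∑ τ, P σ τ = 1) (n : ℕ)
    (σ τ : CoinIndex d) (v : Fin d → ℤ) : pathWeight P r n σ τ v ≤ 1 := by
  have h := hasSum_pathWeight (P := P) (r := r) 0 n σ τ
  simp only [inner_zero_left, Real.exp_zero, mul_one, tiltedMatrix_zero] at h
  refine (le_hasSum h v fun u _ => pathWeight_nonneg hP n σ τ u).trans ?_
  have h1 : P.mulVec 1 = (1 : ℝ) • 1 := by
    ext κ
    simpa only [Matrix.mulVec, dotProduct, Pi.one_apply, mul_one, Pi.smul_apply, one_smul] using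
      hP1 κ
  have h2 := congrFun (pow_mulVec_of_mulVec_eq h1 n) σ
  simp only [Matrix.mulVec, dotProduct, Pi.one_apply, mul_one, one_pow, one_smul] at h2
  rw [← h2]
  exact Finset.single_le_sum (f := fun τ => (P ^ n) σ τ)
    (fun κ _ => Matrix.pow_apply_nonneg hP n σ κ) (Finset.mem_univ τ)

/-- Concatenation through `κ` with the jump split as `u`, `v` produces only some of the paths
counted on the right. -/
lemma pathWeight_mul_le (hP : ∀ σ τ, 0 ≤ P σ τ) (m n : ℕ) (σ κ τ : CoinIndex d)
    (u v : Fin d → ℤ) :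
    pathWeight P r m σ κ u * pathWeight P r n κ τ v ≤ pathWeight P r (m + n) σ τ (u + v) := by
  induction n generalizing τ v with
  | zero =>
    simp only [pathWeight, add_zero]
    split_ifs with h
    · rw [h.1, h.2]; simp
    · simpa using pathWeight_nonneg hP m σ τ (u + v)
  | succ n ih =>
    rw [← add_assoc]
    simp only [pathWeight]
    rw [Finset.mul_sum]
    refine Finset.sum_le_sum fun κ' _ => ?_
    rw [← mul_assoc, add_sub_assoc]
    exact mul_le_mul_of_nonneg_right (ih κ' _) (hP κ' τ)

lemma pathWeight_pow_le (hP : ∀ σ τ, 0 ≤ P σ τ) (n : ℕ) (σ : CoinIndex d) (v : Fin d → ℤ)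
    (k : ℕ) : pathWeight P r n σ σ v ^ k ≤ pathWeight P r (k * n) σ σ (k • v) := by
  induction k with
  | zero => simp [pathWeight]
  | succ k ih =>
    rw [pow_succ, Nat.succ_mul, succ_nsmul]
    exact (mul_le_mul_of_nonneg_right ih (pathWeight_nonneg hP n σ σ v)).trans
      (pathWeight_mul_le hP _ _ _ _ _ _ _)

/-- The lattice points with entries of absolute value at most `m`. -/
noncomputable def latticeBox (d m : ℕ) : Finset (Fin d → ℤ) :=
  Fintype.piFinset fun _ => Finset.Icc (-(m : ℤ)) m

lemma mem_latticeBox {m : ℕ} {v : Fin d → ℤ} : v ∈ latticeBox d m ↔ ∀ i, |v i| ≤ m := by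
  simp [latticeBox, abs_le]

lemma card_latticeBox (m : ℕ) : (latticeBox d m).card = (2 * m + 1) ^ d := by
  simp only [latticeBox, Fintype.card_piFinset, Int.card_Icc, Finset.prod_const,
    Finset.card_univ, Fintype.card_fin]
  congr 1
  omega

lemma sum_latticeBox_pathWeight {R : ℕ} (hR : ∀ τ i, |r τ i| ≤ R)
    (l : EuclideanSpace ℝ (Fin d)) (n : ℕ) (σ τ : CoinIndex d) :
    ∑ v ∈ latticeBox d (n * R), pathWeight P r n σ τ v * Real.exp (inner ℝ l (latticeVec v)) =
      (tiltedMatrix P r l ^ n) σ τ := by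
  refine (hasSum_sum_of_ne_finset_zero fun v hv => ?_).unique (hasSum_pathWeight l n σ τ)
  by_contra h
  refine hv (mem_latticeBox.2 fun i => ?_)
  have := abs_le_of_pathWeight_ne_zero hR n σ τ v (left_ne_zero_of_mul h) i
  exact_mod_cast this

/-- Positive exponential factors leave the quiver of positive entries unchanged. -/
lemma tiltedMatrix_isIrreducible (hP : P.IsIrreducible) (l : EuclideanSpace ℝ (Fin d)) :
    (tiltedMatrix P r l).IsIrreducible := by
  refine ⟨fun σ τ => mul_nonneg (hP.nonneg σ τ) (Real.exp_pos _).le, ?_⟩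
  have h : (tiltedMatrix P r l).toQuiver = P.toQuiver := by
    have : ∀ σ τ, 0 < tiltedMatrix P r l σ τ ↔ 0 < P σ τ := fun σ τ =>
      mul_pos_iff_of_pos_right (Real.exp_pos _)
    simp only [Matrix.toQuiver, this]
  rw [h]
  exact hP.connected

lemma coinIndex_nonempty (hd : 1 ≤ d) : Nonempty (CoinIndex d) :=
  ⟨⟨1, by simp only [Finset.mem_erase, Finset.mem_Icc]; omega⟩⟩

/-- Polynomial factors are absorbed by exponential ones. -/
lemma eventually_box_le_exp (d R : ℕ) {c η : ℝ} (hc : 0 < c) (hη : 0 < η) :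
    ∀ᶠ m : ℕ in atTop, (((2 * (m * R) + 1) ^ d : ℕ) : ℝ) ≤ c * Real.exp (η * m) := by
  have h1 := (isLittleO_pow_exp_pos_mul_atTop d hη).comp_tendsto
    (tendsto_natCast_atTop_atTop (R := ℝ))
  have hK : (0 : ℝ) < (2 * R + 1) ^ d := by positivity
  filter_upwards [h1.def (div_pos hc hK), eventually_ge_atTop 1] with m hm hm1
  simp only [Function.comp_apply, Real.norm_eq_abs, Real.abs_exp] at hm
  rw [abs_of_nonneg (by positivity), div_mul_eq_mul_div, le_div_iff₀ hK, ← mul_pow] at hm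
  refine le_trans ?_ hm
  push_cast
  refine pow_le_pow_left₀ (by positivity) ?_ d
  have : (1 : ℝ) ≤ m := by exact_mod_cast hm1
  nlinarith

end PathWeight

/-! ### Convex duality by separation. -/

section Duality

open Topology

/-- A point below the concave conjugate of the support function `Λ` of a hypograph lies in the
closure of that hypograph. -/
lemma mem_closure_of_forall_inner_sub_le {E : Type*} [NormedAddCommGroup E]
    [InnerProductSpace ℝ E] [CompleteSpace E] {D : Set (E × ℝ)} (hconv : Convex ℝ (closure D))
    (hdown : ∀ y s s', (y, s) ∈ D → s' ≤ s → (y, s') ∈ D) (hneg : ∀ p ∈ D, p.2 ≤ 0)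
    {Λ : E → ℝ} (hΛ : ∀ l, ∀ η > 0, ∃ p ∈ D, Λ l - η ≤ inner ℝ l p.1 + p.2)
    {x : E} {a : ℝ} (hx : ∀ l, inner ℝ l x - Λ l ≤ a) : (x, -a) ∈ closure D := by
  by_contra hnot
  obtain ⟨f, u, hfu, huf⟩ := geometric_hahn_banach_closed_point hconv isClosed_closure hnot
  set l : E := (InnerProductSpace.toDual ℝ E).symm (f.comp (ContinuousLinearMap.inl ℝ E ℝ)) with hl
  set c : ℝ := f (0, 1) with hc
  have hf : ∀ y s, f (y, s) = inner ℝ l y + s * c := by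
    intro y s
    have h1 : (y, s) = (y, (0 : ℝ)) + s • ((0 : E), (1 : ℝ)) := by simp
    rw [h1, map_add, map_smul, smul_eq_mul, hl, InnerProductSpace.toDual_symm_apply]
    simp [hc]
  have hD : ∀ p ∈ D, inner ℝ l p.1 + p.2 * c < u := by
    intro p hp
    have := hfu p (subset_closure hp)
    rwa [← Prod.mk.eta (p := p), hf] at this
  rw [hf] at huf
  obtain ⟨p₀, hp₀, -⟩ := hΛ 0 1 one_pos
  -- `c` is the vertical component of the separating functional. A negative `c` contradicts downward
  -- closedness; a vanishing one (vertical hyperplane) is excluded by scaling `l`; a positive one is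
  -- normalized to 1.
  rcases lt_trichotomy c 0 with hc0 | hc0 | hc0
  · set s : ℝ := min p₀.2 ((u - inner ℝ l p₀.1) / c) with hs
    have h1 := hD (p₀.1, s) (hdown _ _ _ hp₀ (min_le_left _ _))
    have h2 : (u - inner ℝ l p₀.1) / c * c ≤ s * c :=
      mul_le_mul_of_nonpos_right (min_le_right _ _) hc0.le
    rw [div_mul_cancel₀ _ hc0.ne] at h2
    simp only at h1
    linarith
  · rw [hc0] at hD huf
    simp only [mul_zero, add_zero] at hD huf
    -- At tilt `t • l` the support bound with error 1 forces `t` times the gap to be at most `a +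
    -- 1`; this `t` makes it |a| + 2.
    set t : ℝ := (|a| + 2) / (inner ℝ l x - u) with ht
    have hgap : 0 < inner ℝ l x - u := by linarith
    have ht0 : 0 < t := by positivity
    obtain ⟨p, hp, hpl⟩ := hΛ (t • l) 1 one_pos
    have h1 := hx (t • l)
    rw [real_inner_smul_left] at h1 hpl
    have h2 : t * inner ℝ l p.1 ≤ t * u := mul_le_mul_of_nonneg_left (hD p hp).le ht0.le
    have h3 : t * (inner ℝ l x - u) = |a| + 2 := div_mul_cancel₀ _ hgap.ne'
    linarith [hneg p hp, le_abs_self a]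
  · set l' : E := c⁻¹ • l with hl'
    have h1 := hx l'
    rw [real_inner_smul_left] at h1
    have hgap : 0 < c⁻¹ * (inner ℝ l x + -a * c - u) :=
      mul_pos (inv_pos.2 hc0) (by linarith)
    obtain ⟨p, hp, hpl⟩ := hΛ l' _ hgap
    rw [real_inner_smul_left] at hpl
    have h2 : c⁻¹ * (inner ℝ l p.1 + p.2 * c) < c⁻¹ * u :=
      mul_lt_mul_of_pos_left (hD p hp) (inv_pos.2 hc0)
    have h3 : c⁻¹ * (inner ℝ l p.1 + p.2 * c) = c⁻¹ * inner ℝ l p.1 + p.2 := by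
      field_simp
    have h4 : c⁻¹ * (inner ℝ l x + -a * c - u) = c⁻¹ * inner ℝ l x - a - c⁻¹ * u := by
      field_simp
      ring
    linarith

/-- The closure of a set closed under rational convex combinations is convex. -/
lemma convex_closure_of_rational {F : Type*} [NormedAddCommGroup F] [NormedSpace ℝ F]
    {D : Set F} (h : ∀ p ∈ D, ∀ q ∈ D, ∀ a b : ℕ, 0 < a + b →
      ((a : ℝ) / (a + b : ℕ)) • p + ((b : ℝ) / (a + b : ℕ)) • q ∈ D) :
    Convex ℝ (closure D) := by
  intro p hp q hq s t hs ht hst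
  rw [← closure_closure]
  refine map_mem_closure₂ (f := fun p q : F => s • p + t • q) (by fun_prop) hp hq ?_
  intro p hp q hq
  have hs1 : s ≤ 1 := by linarith
  have hle : ∀ n : ℕ, ⌊s * n⌋₊ ≤ n := fun n =>
    Nat.floor_le_of_le (mul_le_of_le_one_left (Nat.cast_nonneg n) hs1)
  have hlim : Tendsto (fun n : ℕ => (⌊s * n⌋₊ : ℝ) / n) atTop (𝓝 s) :=
    (tendsto_nat_floor_mul_div_atTop hs).comp tendsto_natCast_atTop_atTop
  have hlim' : Tendsto (fun n : ℕ => 1 - (⌊s * n⌋₊ : ℝ) / n) atTop (𝓝 t) := by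
    rw [show t = 1 - s by linarith]
    exact tendsto_const_nhds.sub hlim
  refine mem_closure_of_tendsto ((hlim.smul_const p).add (hlim'.smul_const q)) ?_
  filter_upwards [eventually_gt_atTop 0] with n hn
  have h1 := h p hp q hq ⌊s * n⌋₊ (n - ⌊s * n⌋₊) (by have := hle n; omega)
  have hn' : (n : ℝ) ≠ 0 := by positivity
  rw [Nat.add_sub_cancel' (hle n), Nat.cast_sub (hle n), sub_div, div_self hn'] at h1
  exact h1

end Duality

/-! ### Loops and their exponential rates. -/

section LoopSet

variable {d : ℕ}

/-- The pairs `(x, s)` such that the loops at `σ` of some length `n` with mean jump `x` have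
total weight at least `e^{n s}`. -/
def loopSet (P : Matrix (CoinIndex d) (CoinIndex d) ℝ) (r : CoinIndex d → Fin d → ℤ)
    (σ : CoinIndex d) : Set (EuclideanSpace ℝ (Fin d) × ℝ) :=
  {p | ∃ n : ℕ, 0 < n ∧ ∃ v : Fin d → ℤ, (n : ℝ) • p.1 = latticeVec v ∧
    Real.exp (n * p.2) ≤ pathWeight P r n σ σ v}

variable {P : Matrix (CoinIndex d) (CoinIndex d) ℝ} {r : CoinIndex d → Fin d → ℤ}
  {σ : CoinIndex d}

lemma loopSet_snd_nonpos (hP : ∀ σ τ, 0 ≤ P σ τ) (hP1 : ∀ σ, ∑ τ, P σ τ = 1)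
    (p : EuclideanSpace ℝ (Fin d) × ℝ) (hp : p ∈ loopSet P r σ) : p.2 ≤ 0 := by
  obtain ⟨n, hn, v, -, hv⟩ := hp
  have h1 := hv.trans (pathWeight_le_one hP hP1 n σ σ v)
  rw [Real.exp_le_one_iff] at h1
  have : (0 : ℝ) < n := by exact_mod_cast hn
  nlinarith

lemma loopSet_downward (y : EuclideanSpace ℝ (Fin d)) (s s' : ℝ)
    (h : (y, s) ∈ loopSet P r σ) (hs : s' ≤ s) : (y, s') ∈ loopSet P r σ := by
  obtain ⟨n, hn, v, hv, hw⟩ := h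
  refine ⟨n, hn, v, hv, le_trans (Real.exp_le_exp.2 ?_) hw⟩
  exact mul_le_mul_of_nonneg_left hs (Nat.cast_nonneg n)

lemma convex_closure_loopSet (hP : ∀ σ τ, 0 ≤ P σ τ) : Convex ℝ (closure (loopSet P r σ)) := by
  refine convex_closure_of_rational ?_
  rintro ⟨x, s⟩ ⟨m, hm, u, hu, hs⟩ ⟨y, t⟩ ⟨n, hn, v, hv, ht⟩ a b hab
  have hN : (0 : ℝ) < (a + b : ℕ) := by exact_mod_cast hab
  -- Taking `a * n` loops of length `m` and `b * m` of length `n` gives time shares exactly a/(a+b)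
  -- and b/(a+b).
  refine ⟨(a * n) * m + (b * m) * n, ?_, (a * n) • u + (b * m) • v, ?_, ?_⟩
  · have : (a * n) * m + (b * m) * n = (a + b) * (m * n) := by ring
    rw [this]
    positivity
  · rw [latticeVec_add, latticeVec_nsmul, latticeVec_nsmul, ← hu, ← hv]
    simp only [Prod.smul_mk, Prod.mk_add_mk, smul_add, smul_smul]
    congr 2 <;> (push_cast at hN ⊢; field_simp)
  · refine le_trans ?_ (pathWeight_mul_le hP _ _ σ σ σ _ _)
    have h1 := pathWeight_pow_le (r := r) hP m σ u (a * n)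
    have h2 := pathWeight_pow_le (r := r) hP n σ v (b * m)
    have h3 := (pow_le_pow_left₀ (Real.exp_pos _).le hs (a * n)).trans h1
    have h4 := (pow_le_pow_left₀ (Real.exp_pos _).le ht (b * m)).trans h2
    refine le_trans (le_of_eq ?_) (mul_le_mul h3 h4 (by positivity) (pathWeight_nonneg hP _ _ _ _))
    rw [← Real.exp_nat_mul, ← Real.exp_nat_mul, ← Real.exp_add]
    congr 1
    simp only [Prod.smul_mk, Prod.mk_add_mk, smul_eq_mul]
    push_cast at hN ⊢
    field_simp

lemma exists_abs_jump_le (r : CoinIndex d → Fin d → ℤ) : ∃ R : ℕ, ∀ τ i, |r τ i| ≤ R := by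
  refine ⟨∑ τ, ∑ i, (r τ i).natAbs, fun τ i => ?_⟩
  rw [Int.abs_eq_natAbs]
  norm_cast
  exact (Finset.single_le_sum (f := fun i => (r τ i).natAbs) (fun _ _ => Nat.zero_le _)
    (Finset.mem_univ i)).trans (Finset.single_le_sum (f := fun τ => ∑ i, (r τ i).natAbs)
    (fun _ _ => Nat.zero_le _) (Finset.mem_univ τ))

/-- The support function of the loop set is at least the logarithm of the Perron eigenvalue. -/
lemma exists_loopSet_log_perron_le (hd : 1 ≤ d) (hP : P.IsIrreducible)
    (l : EuclideanSpace ℝ (Fin d)) (η : ℝ) (hη : 0 < η) :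
    ∃ p ∈ loopSet P r σ,
      Real.log (perronEigenvalue (tiltedMatrix P r l)) - η ≤ inner ℝ l p.1 + p.2 := by
  have := coinIndex_nonempty hd
  have hA := tiltedMatrix_isIrreducible (r := r) hP l
  set A := tiltedMatrix P r l with hAdef
  set ρ := perronEigenvalue A with hρdef
  have hρ : 0 < ρ := hA.perronEigenvalue_spec.1
  obtain ⟨c, hc, hcm⟩ := exists_le_pow_apply_self hA σ
  obtain ⟨R, hR⟩ := exists_abs_jump_le r
  obtain ⟨N, hN⟩ := eventually_atTop.1 (eventually_box_le_exp d R hc hη)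
  obtain ⟨m, hmN, hm⟩ := hcm (max N 1)
  have hm0 : 0 < m := by have := le_max_right N 1; omega
  have hbox := hN m ((le_max_left _ _).trans hmN)
  have hm' : (0 : ℝ) < m := by exact_mod_cast hm0
  -- Pigeonhole: the box has at most c·e^{ηm} points, while the tilted loop weights sum to at least
  -- c·ρ^m.
  obtain ⟨v, -, hv⟩ : ∃ v ∈ latticeBox d (m * R), Real.exp (-(η * m)) * ρ ^ m ≤
      pathWeight P r m σ σ v * Real.exp (inner ℝ l (latticeVec v)) := by
    by_contra! hcon
    have hne : (latticeBox d (m * R)).Nonempty := ⟨0, mem_latticeBox.2 fun i => by simp; positivity⟩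
    have h1 := Finset.sum_lt_sum_of_nonempty hne hcon
    rw [sum_latticeBox_pathWeight hR, Finset.sum_const, card_latticeBox, nsmul_eq_mul] at h1
    have h2 := (hm.trans_lt h1).trans_le (mul_le_mul_of_nonneg_right hbox (by positivity))
    rw [Real.exp_neg] at h2
    have h3 : c * Real.exp (η * m) * ((Real.exp (η * m))⁻¹ * ρ ^ m) = c * ρ ^ m := by
      field_simp
    rw [h3] at h2
    exact lt_irrefl _ h2
  have hpos : 0 < pathWeight P r m σ σ v :=
    pos_of_mul_pos_left (lt_of_lt_of_le (by positivity) hv) (Real.exp_pos _).le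
  refine ⟨((m : ℝ)⁻¹ • latticeVec v, (m : ℝ)⁻¹ * Real.log (pathWeight P r m σ σ v)),
    ⟨m, hm0, v, ?_, ?_⟩, ?_⟩
  · simp only [smul_smul]
    rw [mul_inv_cancel₀ hm'.ne', one_smul]
  · simp only [← mul_assoc]
    rw [mul_inv_cancel₀ hm'.ne', one_mul, Real.exp_log hpos]
  · have h1 := Real.log_le_log (by positivity) hv
    rw [Real.log_mul (Real.exp_pos _).ne' (by positivity), Real.log_exp, Real.log_pow,
      Real.log_mul hpos.ne' (Real.exp_pos _).ne', Real.log_exp] at h1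
    rw [inner_smul_right]
    refine le_of_mul_le_mul_left ?_ hm'
    have : (m : ℝ) * ((m : ℝ)⁻¹ * inner ℝ l (latticeVec v) +
        (m : ℝ)⁻¹ * Real.log (pathWeight P r m σ σ v)) =
        inner ℝ l (latticeVec v) + Real.log (pathWeight P r m σ σ v) := by
      field_simp
    simp only
    rw [this]
    linarith

/-- Loops realize every point at a cost close to its rate. -/
lemma mem_closure_loopSet (hd : 1 ≤ d) (hP : P.IsIrreducible) (hP1 : ∀ σ, ∑ τ, P σ τ = 1)
    {x : EuclideanSpace ℝ (Fin d)} {a : ℝ}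
    (hx : ∀ l, inner ℝ l x - Real.log (perronEigenvalue (tiltedMatrix P r l)) ≤ a) :
    (x, -a) ∈ closure (loopSet P r σ) :=
  mem_closure_of_forall_inner_sub_le (convex_closure_loopSet hP.nonneg) loopSet_downward
    (loopSet_snd_nonpos hP.nonneg hP1) (exists_loopSet_log_perron_le hd hP) hx

end LoopSet

/-! ### Deterministic estimates along paths. -/

section Paths

variable {d : ℕ}

/-- The sum of the jumps of the first `n` steps of a path. -/
def jumpSum (r : CoinIndex d → Fin d → ℤ) (π : ℕ → Equiv.Perm (CoinIndex d))
    (σ : CoinIndex d) (n : ℕ) : Fin d → ℤ :=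
  ∑ j ∈ Finset.Icc 1 n, r (coinPath π σ j)

variable {r : CoinIndex d → Fin d → ℤ} {π π' : ℕ → Equiv.Perm (CoinIndex d)} {σ : CoinIndex d}

lemma jumpSum_succ (n : ℕ) :
    jumpSum r π σ (n + 1) = jumpSum r π σ n + r (coinPath π σ (n + 1)) :=
  Finset.sum_Icc_succ_top (by omega) _

lemma coinPath_congr {n : ℕ} (h : ∀ k < n, π k = π' k) {j : ℕ} (hj : j ≤ n) :
    coinPath π σ j = coinPath π' σ j := by
  induction j with
  | zero => rfl
  | succ j ih => rw [coinPath, coinPath, ih (by omega), h j (by omega)]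

lemma jumpSum_congr {n : ℕ} (h : ∀ k < n, π k = π' k) :
    jumpSum r π σ n = jumpSum r π' σ n :=
  Finset.sum_congr rfl fun j hj => by rw [coinPath_congr h (Finset.mem_Icc.1 hj).2]

lemma jumpSum_mem_latticeBox {R : ℕ} (hR : ∀ τ i, |r τ i| ≤ R) (n : ℕ) :
    jumpSum r π σ n ∈ latticeBox d (n * R) := by
  refine mem_latticeBox.2 fun i => ?_
  rw [jumpSum, Finset.sum_apply]
  refine (Finset.abs_sum_le_sum_abs _ _).trans ((Finset.sum_le_sum fun j _ => hR _ i).trans ?_)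
  simp

lemma latticeVec_jumpSum (n : ℕ) :
    latticeVec (jumpSum r π σ n) = ∑ j ∈ Finset.Icc 1 n, jumpVec r (coinPath π σ j) := by
  induction n with
  | zero => simp [jumpSum, latticeVec_zero]
  | succ n ih =>
    rw [jumpSum_succ, latticeVec_add, ih, Finset.sum_Icc_succ_top (by omega)]
    rfl

lemma meanJump_eq (n : ℕ) :
    meanJump r π σ n = (n : ℝ)⁻¹ • latticeVec (jumpSum r π σ n) := by
  rw [latticeVec_jumpSum, meanJump]

lemma exists_norm_jumpVec_le (r : CoinIndex d → Fin d → ℤ) :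
    ∃ L : ℝ, 0 ≤ L ∧ ∀ τ, ‖jumpVec r τ‖ ≤ L :=
  ⟨∑ τ, ‖jumpVec r τ‖, Finset.sum_nonneg fun _ _ => norm_nonneg _, fun τ =>
    Finset.single_le_sum (f := fun τ => ‖jumpVec r τ‖) (fun _ _ => norm_nonneg _)
      (Finset.mem_univ τ)⟩

lemma norm_jumpSum_add_sub_le {L : ℝ} (hL : ∀ τ, ‖jumpVec r τ‖ ≤ L) (m j : ℕ) :
    ‖latticeVec (jumpSum r π σ (m + j)) - latticeVec (jumpSum r π σ m)‖ ≤ j * L := by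
  induction j with
  | zero => simp
  | succ j ih =>
    rw [← add_assoc, jumpSum_succ, latticeVec_add, add_sub_right_comm]
    refine (norm_add_le _ _).trans ?_
    push_cast
    have : ‖latticeVec (r (coinPath π σ (m + j + 1)))‖ ≤ L := hL _
    linarith

lemma norm_meanJump_le {L : ℝ} (hL0 : 0 ≤ L) (hL : ∀ τ, ‖jumpVec r τ‖ ≤ L) (n : ℕ) :
    ‖meanJump r π σ n‖ ≤ L := by
  have h := norm_jumpSum_add_sub_le (π := π) (σ := σ) hL 0 n
  rw [zero_add, show jumpSum r π σ 0 = 0 by simp [jumpSum], latticeVec_zero, sub_zero] at h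
  rw [meanJump_eq, norm_smul, norm_inv, Real.norm_natCast]
  rcases Nat.eq_zero_or_pos n with rfl | hn
  · simpa using hL0
  · have hn' : (0 : ℝ) < n := by exact_mod_cast hn
    rw [inv_mul_le_iff₀ hn']
    exact h

end Paths

/-! ### The law of the chain and its probability estimates. -/

section CoinChain

variable {d : ℕ}

instance permMeasurableSpace (d : ℕ) : MeasurableSpace (Equiv.Perm (CoinIndex d)) := ⊤

instance permDiscreteMeasurableSpace (d : ℕ) :
    DiscreteMeasurableSpace (Equiv.Perm (CoinIndex d)) := ⟨fun _ => trivial⟩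

/-- The graph of a permutation as a relation. -/
def permGraph (p : Equiv.Perm (CoinIndex d)) : CoinIndex d → CoinIndex d → Prop :=
  fun σ τ => σ = p τ

lemma permGraph_injective : Function.Injective (permGraph (d := d)) := by
  intro p q h
  ext1 τ
  have h1 : permGraph p (p τ) τ := rfl
  rw [h] at h1
  exact h1

/-- The permutation read off the support of a coin matrix. -/
noncomputable def supportPerm (M : Matrix (CoinIndex d) (CoinIndex d) ℂ) :
    Equiv.Perm (CoinIndex d) :=
  Function.invFun permGraph fun σ τ => M σ τ ≠ 0

/-- Phase factors never vanish, so the support of a coin forgets the phases and determines the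
permutation. -/
lemma supportPerm_coinMatrix (p : Equiv.Perm (CoinIndex d)) (θ : CoinIndex d → ℝ) :
    supportPerm (coinMatrix p θ) = p := by
  have : (fun σ τ => coinMatrix p θ σ τ ≠ 0) = permGraph p := by
    funext σ τ
    simp [coinMatrix, permGraph, Complex.exp_ne_zero]
  rw [supportPerm, this, Function.leftInverse_invFun permGraph_injective]

lemma measurable_supportPerm : Measurable (supportPerm (d := d)) := by
  have h1 : Measurable (Function.invFun (permGraph (d := d))) := Measurable.of_discrete
  refine h1.comp (measurable_pi_lambda _ fun σ => measurable_pi_lambda _ fun τ => ?_)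
  refine measurable_to_prop ?_
  have h2 : Measurable fun M : Matrix (CoinIndex d) (CoinIndex d) ℂ => M σ τ :=
    (measurable_pi_apply τ).comp (measurable_pi_apply σ)
  exact h2 (measurableSet_singleton (0 : ℂ)).compl |>.congr (by ext; simp)

variable {Ω : Type*} [MeasurableSpace Ω] {ν : Measure Ω} [IsProbabilityMeasure ν]
  {π : ℕ → Ω → Equiv.Perm (CoinIndex d)}
  {P : Matrix (CoinIndex d) (CoinIndex d) ℝ} {r : CoinIndex d → Fin d → ℤ}

lemma transitionMatrix_eq {C : Ω → Matrix (CoinIndex d) (CoinIndex d) ℂ}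
    {p : Ω → Equiv.Perm (CoinIndex d)} {θ : Ω → CoinIndex d → ℝ}
    (hC : ∀ ω, C ω = coinMatrix (p ω) (θ ω)) (hp : Measurable p) (κ τ : CoinIndex d) :
    transitionMatrix ν C κ τ = ν.real {ω | p ω κ = τ} := by
  have h1 : ∀ q, permLaw ν C q = ν.real (p ⁻¹' {q}) := by
    intro q
    rw [permLaw]
    congr 1
    ext ω
    constructor
    · rintro ⟨θ', h⟩
      have := congrArg supportPerm h
      rw [hC, supportPerm_coinMatrix, supportPerm_coinMatrix] at this
      exact this
    · rintro rfl
      exact ⟨θ ω, hC ω⟩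
  have h2 : {ω | p ω κ = τ} =
      p ⁻¹' ((Finset.univ.filter fun q : Equiv.Perm (CoinIndex d) => τ = q κ : Finset _) :
      Set (Equiv.Perm (CoinIndex d))) := by
    ext ω; simp [eq_comm]
  rw [h2, ← sum_measureReal_preimage_singleton _ fun q _ => hp (measurableSet_singleton q)]
  simp only [transitionMatrix, h1, mul_ite, mul_one, mul_zero, Finset.sum_filter]

/-- The joint law of the position and the sum of the jumps is given by the path weights. -/
lemma measureReal_path_eq (hπ : ∀ k, Measurable (π k)) (hind : iIndepFun π ν)
    (hlaw : ∀ k κ τ, ν.real {ω | π k ω κ = τ} = P κ τ) (n : ℕ) (σ τ : CoinIndex d)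
    (v : Fin d → ℤ) :
    ν.real {ω | coinPath (fun k => π k ω) σ n = τ ∧ jumpSum r (fun k => π k ω) σ n = v} =
      pathWeight P r n σ τ v := by
  induction n generalizing τ v with
  | zero =>
    simp only [coinPath, jumpSum, pathWeight]
    by_cases h : σ = τ ∧ v = 0
    · simp [h.1, h.2]
    · rw [if_neg h]
      have : {ω : Ω | σ = τ ∧ ∑ j ∈ Finset.Icc 1 0, r (coinPath (fun k => π k ω) σ j) = v} = ∅ := by
        ext ω
        simpa [eq_comm] using h
      rw [this, measureReal_empty]
  | succ n ih =>
    -- Padding the first `n` permutations with the identity exhibits the past event as a function of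
    -- finitely many coordinates, independent of the next permutation.
    set ext' : (Finset.range n → Equiv.Perm (CoinIndex d)) → ℕ → Equiv.Perm (CoinIndex d) :=
      fun q k => if h : k ∈ Finset.range n then q ⟨k, h⟩ else 1 with hext
    have hagree : ∀ ω, ∀ k < n, (fun k => π k ω) k = ext' (fun i => π i ω) k := by
      intro ω k hk
      simp [hext, hk]
    set A : CoinIndex d → Set Ω := fun κ =>
      {ω | coinPath (fun k => π k ω) σ n = κ ∧ jumpSum r (fun k => π k ω) σ n = v - r τ} with hA
    set B : CoinIndex d → Set Ω := fun κ => {ω | π n ω κ = τ} with hB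
    have hA' : ∀ κ, A κ = (fun ω (i : Finset.range n) => π i ω) ⁻¹'
        {q | coinPath (ext' q) σ n = κ ∧ jumpSum r (ext' q) σ n = v - r τ} := by
      intro κ
      ext ω
      simp only [hA, Set.mem_ofPred_eq, Set.mem_preimage]
      rw [coinPath_congr (hagree ω) le_rfl, jumpSum_congr (hagree ω)]
    have hB' : ∀ κ, B κ = (fun ω (i : ({n} : Finset ℕ)) => π i ω) ⁻¹'
        {q | q ⟨n, Finset.mem_singleton_self n⟩ κ = τ} := fun κ => rfl
    have hpast : Measurable (fun ω (i : Finset.range n) => π i ω) :=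
      measurable_pi_lambda _ fun i => hπ i
    have hnext : Measurable (fun ω (i : ({n} : Finset ℕ)) => π i ω) :=
      measurable_pi_lambda _ fun i => hπ i
    have hAB : ∀ κ, ν.real (A κ ∩ B κ) = pathWeight P r n σ κ (v - r τ) * P κ τ := by
      intro κ
      have h := (hind.indepFun_finset (Finset.range n) {n} (by simp) hπ).measure_inter_preimage_eq_mul
        {q | coinPath (ext' q) σ n = κ ∧ jumpSum r (ext' q) σ n = v - r τ}
        {q | q ⟨n, Finset.mem_singleton_self n⟩ κ = τ}
        (MeasurableSet.of_discrete) (MeasurableSet.of_discrete)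
      rw [← hA', ← hB'] at h
      rw [measureReal_def, h, ENNReal.toReal_mul, ← measureReal_def, ← measureReal_def, ih,
        hlaw n κ τ]
    have hmeasAB : ∀ κ, MeasurableSet (A κ ∩ B κ) := by
      intro κ
      rw [hA', hB']
      exact (hpast MeasurableSet.of_discrete).inter (hnext MeasurableSet.of_discrete)
    have hunion : {ω | coinPath (fun k => π k ω) σ (n + 1) = τ ∧
        jumpSum r (fun k => π k ω) σ (n + 1) = v} = ⋃ κ ∈ Finset.univ, A κ ∩ B κ := by
      ext ω
      simp only [Set.mem_ofPred_eq, Set.mem_iUnion, Finset.mem_univ, exists_const, Set.mem_inter_iff,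
        hA, hB, jumpSum_succ]
      constructor
      · rintro ⟨h1, h2⟩
        rw [h1] at h2
        exact ⟨_, ⟨rfl, eq_sub_of_add_eq h2⟩, h1⟩
      · rintro ⟨κ, ⟨h1, h2⟩, h3⟩
        have h4 : coinPath (fun k => π k ω) σ (n + 1) = τ := by rw [coinPath, h1]; exact h3
        exact ⟨h4, by rw [h4, h2, sub_add_cancel]⟩
    rw [hunion, measureReal_biUnion_finset ?_ fun κ _ => hmeasAB κ]
    · exact Finset.sum_congr rfl fun κ _ => hAB κ
    · intro κ _ κ' _ hne
      refine Set.disjoint_left.2 fun ω h h' => hne ?_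
      exact h.1.1.symm.trans h'.1.1

/-- Chernoff bound on half-spaces. -/
lemma exists_measureReal_halfSpace_le (hd : 1 ≤ d) (hP : P.IsIrreducible) {σ : CoinIndex d}
    (hpath : ∀ n τ v, ν.real {ω | coinPath (fun k => π k ω) σ n = τ ∧
      jumpSum r (fun k => π k ω) σ n = v} = pathWeight P r n σ τ v)
    (l : EuclideanSpace ℝ (Fin d)) (b : ℝ) :
    ∃ K > 0, ∀ n : ℕ, 0 < n →
      ν.real {ω | b < inner ℝ l (meanJump r (fun k => π k ω) σ n) -
        Real.log (perronEigenvalue (tiltedMatrix P r l))} ≤ K * Real.exp (-(n * b)) := by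
  have := coinIndex_nonempty hd
  have hA := tiltedMatrix_isIrreducible (r := r) hP l
  obtain ⟨K, hK, hle⟩ := exists_sum_pow_le hA
  have hρ := hA.perronEigenvalue_spec.1
  set ρ := perronEigenvalue (tiltedMatrix P r l)
  obtain ⟨R, hR⟩ := exists_abs_jump_le r
  refine ⟨K, hK, fun n hn => ?_⟩
  have hn' : (0 : ℝ) < n := by exact_mod_cast hn
  set V := (latticeBox d (n * R)).filter
    fun v => n * (b + Real.log ρ) ≤ inner ℝ l (latticeVec v) with hV
  have hsub : {ω | b < inner ℝ l (meanJump r (fun k => π k ω) σ n) - Real.log ρ} ⊆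
      ⋃ q ∈ (Finset.univ : Finset (CoinIndex d)) ×ˢ V,
        {ω | coinPath (fun k => π k ω) σ n = q.1 ∧ jumpSum r (fun k => π k ω) σ n = q.2} := by
    intro ω hω
    simp only [Set.mem_ofPred_eq, meanJump_eq, inner_smul_right] at hω
    refine Set.mem_biUnion (x := (coinPath (fun k => π k ω) σ n, jumpSum r (fun k => π k ω) σ n))
      ?_ ⟨rfl, rfl⟩
    simp only [Finset.coe_product, Finset.coe_univ, Set.mem_prod, Set.mem_univ, true_and,
      Finset.mem_coe, hV, Finset.mem_filter]
    refine ⟨jumpSum_mem_latticeBox hR n, ?_⟩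
    have h1 := mul_lt_mul_of_pos_left (lt_sub_iff_add_lt.1 hω) hn'
    rw [mul_inv_cancel_left₀ hn'.ne'] at h1
    exact h1.le
  have hexp : Real.exp (-(n * (b + Real.log ρ))) * ρ ^ n = Real.exp (-(n * b)) := by
    rw [← Real.exp_log (pow_pos hρ n), Real.log_pow, ← Real.exp_add]
    congr 1
    ring
  calc _ ≤ _ := measureReal_mono hsub (measure_ne_top _ _)
    _ ≤ _ := measureReal_biUnion_finset_le _ _
    _ = ∑ τ, ∑ v ∈ V, pathWeight P r n σ τ v := by
        rw [Finset.sum_product]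
        exact Finset.sum_congr rfl fun τ _ => Finset.sum_congr rfl fun v _ => hpath n τ v
    _ ≤ ∑ τ, Real.exp (-(n * (b + Real.log ρ))) * (tiltedMatrix P r l ^ n) σ τ := by
        refine Finset.sum_le_sum fun τ _ => ?_
        rw [← sum_latticeBox_pathWeight hR, Finset.mul_sum]
        refine le_trans (Finset.sum_le_sum fun v hv => ?_)
          (Finset.sum_le_sum_of_subset_of_nonneg (Finset.filter_subset _ _) fun v _ _ => ?_)
        · rw [mul_left_comm, ← Real.exp_add]
          refine le_mul_of_one_le_right (pathWeight_nonneg hP.nonneg _ _ _ _) ?_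
          rw [Real.one_le_exp_iff]
          linarith [(Finset.mem_filter.1 hv).2]
        · have := pathWeight_nonneg (r := r) hP.nonneg n σ τ v
          positivity
    _ = Real.exp (-(n * (b + Real.log ρ))) * ∑ τ, (tiltedMatrix P r l ^ n) σ τ := by
        rw [Finset.mul_sum]
    _ ≤ Real.exp (-(n * (b + Real.log ρ))) * (K * ρ ^ n) :=
        mul_le_mul_of_nonneg_left (hle n σ) (Real.exp_pos _).le
    _ = K * Real.exp (-(n * b)) := by rw [← hexp]; ring

/-- Lower bound on the probability of a neighbourhood of the mean jump of a loop. -/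
lemma eventually_le_measureReal_of_mem_loopSet (hP : ∀ σ τ, 0 ≤ P σ τ)
    (hP1 : ∀ σ, ∑ τ, P σ τ = 1) {σ : CoinIndex d}
    (hpath : ∀ n τ v, ν.real {ω | coinPath (fun k => π k ω) σ n = τ ∧
      jumpSum r (fun k => π k ω) σ n = v} = pathWeight P r n σ τ v)
    {y : EuclideanSpace ℝ (Fin d)} {s : ℝ} (hys : (y, s) ∈ loopSet P r σ) {ε : ℝ} (hε : 0 < ε) :
    ∀ᶠ n : ℕ in atTop, Real.exp (n * s) ≤
      ν.real {ω | meanJump r (fun k => π k ω) σ n ∈ Metric.ball y ε} := by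
  have hs : s ≤ 0 := loopSet_snd_nonpos hP hP1 _ hys
  obtain ⟨m, hm, v, hv, hw⟩ := hys
  obtain ⟨L, hL0, hL⟩ := exists_norm_jumpVec_le r
  -- After full loops of length `m`, the remainder displaces the sum from `n • y` by at most `m * (L
  -- + ‖y‖)`, which must be below `n * ε`.
  have hlim := tendsto_natCast_atTop_atTop (R := ℝ).eventually_gt_atTop (m * (L + ‖y‖) / ε)
  filter_upwards [hlim, eventually_gt_atTop 0] with n hn hn0
  have hn' : (0 : ℝ) < n := by exact_mod_cast hn0
  set k := n / m with hk
  set j := n % m with hj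
  have hnkj : k * m + j = n := Nat.div_add_mod' n m
  have hjm : (j : ℝ) ≤ m := by exact_mod_cast (Nat.mod_lt n hm).le
  have hkm : ((k * m : ℕ) : ℝ) ≤ n := by exact_mod_cast Nat.div_mul_le_self n m
  -- Rounding the length down to a multiple of `m` costs nothing because `s ≤ 0`.
  calc Real.exp (n * s) ≤ Real.exp ((k * m : ℕ) * s) :=
        Real.exp_le_exp.2 (mul_le_mul_of_nonpos_right hkm hs)
    _ = Real.exp (m * s) ^ k := by
        rw [← Real.exp_nat_mul]
        push_cast
        ring_nf
    _ ≤ pathWeight P r m σ σ v ^ k := pow_le_pow_left₀ (Real.exp_pos _).le hw k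
    _ ≤ pathWeight P r (k * m) σ σ (k • v) := pathWeight_pow_le hP m σ v k
    _ = _ := (hpath (k * m) σ (k • v)).symm
    _ ≤ _ := measureReal_mono ?_ (measure_ne_top _ _)
  rintro ω ⟨-, hω⟩
  have h1 := norm_jumpSum_add_sub_le (π := fun k => π k ω) (σ := σ) hL (k * m) j
  rw [hω, hnkj, latticeVec_nsmul, ← hv] at h1
  simp only at h1
  set S := latticeVec (jumpSum r (fun k => π k ω) σ n) with hS
  have h2 : S - (n : ℝ) • y = (S - (k : ℝ) • (m : ℝ) • y) - (j : ℝ) • y := by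
    rw [← hnkj, smul_smul]
    push_cast
    rw [add_smul]
    abel
  have h3 : ‖S - (n : ℝ) • y‖ ≤ m * (L + ‖y‖) := by
    rw [h2]
    refine (norm_sub_le _ _).trans ?_
    rw [norm_smul, Real.norm_natCast, mul_add]
    exact add_le_add (h1.trans (mul_le_mul_of_nonneg_right hjm hL0))
      (mul_le_mul_of_nonneg_right hjm (norm_nonneg y))
  have h4 : meanJump r (fun k => π k ω) σ n - y = (n : ℝ)⁻¹ • (S - (n : ℝ) • y) := by
    rw [meanJump_eq, smul_sub, smul_smul, inv_mul_cancel₀ hn'.ne', one_smul]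
  rw [Set.mem_ofPred_eq, Metric.mem_ball, dist_eq_norm, h4, norm_smul, norm_inv, Real.norm_natCast,
    inv_mul_lt_iff₀ hn']
  exact h3.trans_lt ((div_lt_iff₀ hε).1 hn)

end CoinChain

/-! ### Convexity and goodness of the rate function. -/

section RateFunction

variable {d : ℕ} {P : Matrix (CoinIndex d) (CoinIndex d) ℝ} {r : CoinIndex d → Fin d → ℤ}

lemma sub_log_le_rateFunction (l x : EuclideanSpace ℝ (Fin d)) :
    ((inner ℝ l x - Real.log (perronEigenvalue (tiltedMatrix P r l)) : ℝ) : EReal) ≤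
      rateFunction P r x :=
  le_iSup (fun l : EuclideanSpace ℝ (Fin d) =>
    ((inner ℝ l x - Real.log (perronEigenvalue (tiltedMatrix P r l)) : ℝ) : EReal)) l

/-- A row-sum bound. At `l = 0` it gives nonnegativity of the rate function, at unit vectors
boundedness of its sublevel sets. -/
lemma log_perronEigenvalue_le (hd : 1 ≤ d) (hP : P.IsIrreducible) (hP1 : ∀ σ, ∑ τ, P σ τ = 1)
    {L : ℝ} (hL : ∀ τ, ‖jumpVec r τ‖ ≤ L) (l : EuclideanSpace ℝ (Fin d)) :
    Real.log (perronEigenvalue (tiltedMatrix P r l)) ≤ ‖l‖ * L := by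
  have := coinIndex_nonempty hd
  have hA := tiltedMatrix_isIrreducible (r := r) hP l
  rw [Real.log_le_iff_le_exp hA.perronEigenvalue_spec.1]
  refine perronEigenvalue_le_of_sum_le hA fun σ => ?_
  calc ∑ τ, tiltedMatrix P r l σ τ ≤ ∑ τ, P σ τ * Real.exp (‖l‖ * L) :=
        Finset.sum_le_sum fun τ _ => mul_le_mul_of_nonneg_left
          (Real.exp_le_exp.2 ((real_inner_le_norm _ _).trans
            (mul_le_mul_of_nonneg_left (hL τ) (norm_nonneg l)))) (hP.nonneg σ τ)
    _ = Real.exp (‖l‖ * L) := by rw [← Finset.sum_mul, hP1, one_mul]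

lemma isConvexEReal_rateFunction : IsConvexEReal (rateFunction P r) := by
  intro x y a b ha hb hab
  refine iSup_le fun l => ?_
  set c := Real.log (perronEigenvalue (tiltedMatrix P r l)) with hc
  have h : inner ℝ l (a • x + b • y) - c = a * (inner ℝ l x - c) + b * (inner ℝ l y - c) := by
    rw [inner_add_right, inner_smul_right, inner_smul_right]
    linear_combination c * hab
  rw [h, EReal.coe_add, EReal.coe_mul, EReal.coe_mul]
  exact add_le_add
    (mul_le_mul_of_nonneg_left (sub_log_le_rateFunction l x) (EReal.coe_nonneg.2 ha))
    (mul_le_mul_of_nonneg_left (sub_log_le_rateFunction l y) (EReal.coe_nonneg.2 hb))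

lemma isGoodRateFunction_rateFunction (hd : 1 ≤ d) (hP : P.IsIrreducible)
    (hP1 : ∀ σ, ∑ τ, P σ τ = 1) : IsGoodRateFunction (rateFunction P r) := by
  obtain ⟨L, hL0, hL⟩ := exists_norm_jumpVec_le r
  have hlsc : LowerSemicontinuous (rateFunction P r) := by
    refine lowerSemicontinuous_iSup fun l => Continuous.lowerSemicontinuous ?_
    exact continuous_coe_real_ereal.comp (by fun_prop)
  refine ⟨fun x => ?_, hlsc, fun a => ?_⟩
  · refine le_trans ?_ (sub_log_le_rateFunction 0 x)
    have := log_perronEigenvalue_le hd hP hP1 hL 0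
    rw [norm_zero, zero_mul] at this
    rw [inner_zero_left]
    exact_mod_cast (by linarith : (0 : ℝ) ≤ 0 - _)
  · refine (isCompact_closedBall (0 : EuclideanSpace ℝ (Fin d)) (a + L)).of_isClosed_subset
      (hlsc.isClosed_preimage (a : EReal)) fun x hx => ?_
    rw [mem_closedBall_zero_iff]
    rcases eq_or_ne x 0 with rfl | hx0
    · have h1 := (sub_log_le_rateFunction (P := P) (r := r) 0 0).trans hx
      have h2 := log_perronEigenvalue_le hd hP hP1 hL 0
      rw [EReal.coe_le_coe_iff, inner_zero_left] at h1
      rw [norm_zero, zero_mul] at h2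
      rw [norm_zero]
      linarith
    · have hn : ‖x‖ ≠ 0 := norm_ne_zero_iff.2 hx0
      -- Testing with the unit vector along `x` yields ‖x‖ − L ≤ a.
      have h1 := (sub_log_le_rateFunction (P := P) (r := r) (‖x‖⁻¹ • x) x).trans hx
      have h2 := log_perronEigenvalue_le hd hP hP1 hL (‖x‖⁻¹ • x)
      rw [norm_smul, norm_inv, norm_norm, inv_mul_cancel₀ hn, one_mul] at h2
      rw [EReal.coe_le_coe_iff, real_inner_smul_left, real_inner_self_eq_norm_mul_norm,
        inv_mul_cancel_left₀ hn] at h1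
      linarith

end RateFunction

/-! ### The two large deviation bounds. -/

section LargeDeviations

variable {Ω : Type*} [MeasurableSpace Ω] {ν : Measure Ω} [IsProbabilityMeasure ν]

lemma le_log_measure_div {A : Set Ω} {n : ℕ} (hn : 0 < n) {s : ℝ}
    (h : Real.exp (n * s) ≤ ν.real A) : (s : EReal) ≤ ENNReal.log (ν A) / (n : EReal) := by
  have hn' : (n : ℝ) ≠ 0 := by positivity
  rw [EReal.le_div_iff_mul_le (by exact_mod_cast hn) (EReal.natCast_ne_top n)]
  have h1 : ENNReal.ofReal (Real.exp (n * s)) ≤ ν A := by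
    rw [← ofReal_measureReal]
    exact ENNReal.ofReal_le_ofReal h
  have h2 := ENNReal.log_le_log h1
  rw [ENNReal.log_ofReal_of_pos (Real.exp_pos _), Real.log_exp, mul_comm] at h2
  exact_mod_cast h2

lemma log_measure_div_le {A : Set Ω} {n : ℕ} (hn : 0 < n) {s : ℝ}
    (h : ν.real A ≤ Real.exp (n * s)) : ENNReal.log (ν A) / (n : EReal) ≤ (s : EReal) := by
  rw [EReal.div_le_iff_le_mul (by exact_mod_cast hn) (EReal.natCast_ne_top n)]
  have h1 : ν A ≤ ENNReal.ofReal (Real.exp (n * s)) := by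
    rw [← ofReal_measureReal]
    exact ENNReal.ofReal_le_ofReal h
  have h2 := ENNReal.log_le_log h1
  rw [ENNReal.log_ofReal_of_pos (Real.exp_pos _), Real.log_exp] at h2
  exact_mod_cast h2

variable {d : ℕ} {P : Matrix (CoinIndex d) (CoinIndex d) ℝ} {r : CoinIndex d → Fin d → ℤ}
  {π : ℕ → Ω → Equiv.Perm (CoinIndex d)} {σ : CoinIndex d}

lemma neg_rateFunction_le_liminf (hd : 1 ≤ d) (hP : P.IsIrreducible)
    (hP1 : ∀ σ, ∑ τ, P σ τ = 1)
    (hpath : ∀ n τ v, ν.real {ω | coinPath (fun k => π k ω) σ n = τ ∧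
      jumpSum r (fun k => π k ω) σ n = v} = pathWeight P r n σ τ v)
    {Γ : Set (EuclideanSpace ℝ (Fin d))} {x : EuclideanSpace ℝ (Fin d)} (hx : x ∈ interior Γ) :
    -rateFunction P r x ≤ liminf (fun n : ℕ =>
      ENNReal.log (ν {ω | meanJump r (fun k => π k ω) σ n ∈ Γ}) / (n : EReal)) atTop := by
  rw [EReal.neg_le, ← EReal.le_of_forall_lt_iff_le]
  intro b hb
  rw [EReal.neg_le, ← EReal.coe_neg]
  obtain ⟨a, hxa, hab⟩ := EReal.lt_iff_exists_real_btwn.1 hb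
  have hab' : a < b := by exact_mod_cast hab
  obtain ⟨ε, hε, hball⟩ := Metric.mem_nhds_iff.1 (mem_interior_iff_mem_nhds.1 hx)
  have hmem : (x, -a) ∈ closure (loopSet P r σ) := mem_closure_loopSet hd hP hP1 fun l => by
    exact_mod_cast (sub_log_le_rateFunction l x).trans hxa.le
  -- The tolerance `ε / 2` keeps a half-radius ball around `y` inside Γ; `b - a` ensures `-b ≤ s`.
  obtain ⟨⟨y, s⟩, hys, hdist⟩ := Metric.mem_closure_iff.1 hmem (min (ε / 2) (b - a))
    (lt_min (by linarith) (by linarith))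
  rw [Prod.dist_eq, max_lt_iff] at hdist
  have hxy : dist x y < ε / 2 := hdist.1.trans_le (min_le_left _ _)
  have hs : -b ≤ s := by
    have := hdist.2.trans_le (min_le_right _ _)
    rw [Real.dist_eq, abs_lt] at this
    simp only at this
    linarith [this.2]
  refine le_liminf_of_le ?_ ?_
  · isBoundedDefault
  filter_upwards [eventually_le_measureReal_of_mem_loopSet hP.nonneg hP1 hpath hys (half_pos hε),
    eventually_gt_atTop 0] with n hn hn0
  refine le_log_measure_div hn0 (le_trans (Real.exp_le_exp.2 ?_) (hn.trans ?_))
  · exact mul_le_mul_of_nonneg_left hs (Nat.cast_nonneg n)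
  · refine measureReal_mono (fun ω hω => hball ?_) (measure_ne_top _ _)
    have h1 : dist (meanJump r (fun k => π k ω) σ n) y < ε / 2 := hω
    rw [Metric.mem_ball]
    have := dist_triangle_right (meanJump r (fun k => π k ω) σ n) x y
    linarith

lemma limsup_le_neg_rateFunction (hd : 1 ≤ d) (hP : P.IsIrreducible)
    (hpath : ∀ n τ v, ν.real {ω | coinPath (fun k => π k ω) σ n = τ ∧
      jumpSum r (fun k => π k ω) σ n = v} = pathWeight P r n σ τ v)
    (Γ : Set (EuclideanSpace ℝ (Fin d))) :
    limsup (fun n : ℕ =>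
      ENNReal.log (ν {ω | meanJump r (fun k => π k ω) σ n ∈ Γ}) / (n : EReal)) atTop ≤
      -(⨅ x ∈ closure Γ, rateFunction P r x) := by
  rw [EReal.le_neg, ← EReal.ge_of_forall_gt_iff_ge]
  intro a ha
  rw [EReal.le_neg, ← EReal.coe_neg]
  obtain ⟨b, hab, hb⟩ := EReal.lt_iff_exists_real_btwn.1 ha
  have hab' : a < b := by exact_mod_cast hab
  obtain ⟨L, hL0, hL⟩ := exists_norm_jumpVec_le r
  set U : EuclideanSpace ℝ (Fin d) → Set (EuclideanSpace ℝ (Fin d)) := fun l =>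
    {x | b < inner ℝ l x - Real.log (perronEigenvalue (tiltedMatrix P r l))} with hU
  -- All Z_n lie in the ball of radius `L`, so exponential tightness is automatic and only this
  -- compact part matters.
  have hQ : IsCompact (closure Γ ∩ Metric.closedBall 0 L) :=
    (isCompact_closedBall _ _).inter_left isClosed_closure
  obtain ⟨t, ht⟩ := hQ.elim_finite_subcover U
    (fun l => isOpen_lt continuous_const (by fun_prop)) fun x hx => by
      have h1 : (b : EReal) < rateFunction P r x := hb.trans_le (iInf₂_le x hx.1)
      obtain ⟨l, hl⟩ := lt_iSup_iff.1 h1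
      exact Set.mem_iUnion.2 ⟨l, by exact_mod_cast hl⟩
  choose K hK hKle using fun l => exists_measureReal_halfSpace_le hd hP hpath l b
  set M : ℝ := ∑ l ∈ t, K l with hM
  -- The gap `b - a` absorbs the constant of the finite union bound.
  have hlim : ∀ᶠ n : ℕ in atTop, M ≤ Real.exp (n * (b - a)) :=
    (Real.tendsto_exp_atTop.comp (tendsto_natCast_atTop_atTop.atTop_mul_const
      (sub_pos.2 hab'))).eventually_ge_atTop M
  refine limsup_le_of_le ?_ ?_
  · isBoundedDefault
  filter_upwards [hlim, eventually_gt_atTop 0] with n hn hn0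
  refine log_measure_div_le hn0 ?_
  calc ν.real {ω | meanJump r (fun k => π k ω) σ n ∈ Γ}
      ≤ ν.real (⋃ l ∈ t, {ω | meanJump r (fun k => π k ω) σ n ∈ U l}) := by
        refine measureReal_mono (fun ω hω => ?_) (measure_ne_top _ _)
        have h1 := ht ⟨subset_closure hω,
          mem_closedBall_zero_iff.2 (norm_meanJump_le (π := fun k => π k ω) (σ := σ) hL0 hL n)⟩
        rw [Set.mem_iUnion₂] at h1 ⊢
        exact h1
    _ ≤ ∑ l ∈ t, ν.real {ω | meanJump r (fun k => π k ω) σ n ∈ U l} :=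
        measureReal_biUnion_finset_le _ _
    _ ≤ ∑ l ∈ t, K l * Real.exp (-(n * b)) := Finset.sum_le_sum fun l _ => hKle l n hn0
    _ = M * Real.exp (-(n * b)) := by rw [Finset.sum_mul]
    _ ≤ Real.exp (n * (b - a)) * Real.exp (-(n * b)) :=
        mul_le_mul_of_nonneg_right hn (Real.exp_pos _).le
    _ = Real.exp (n * -a) := by
        rw [← Real.exp_add]
        congr 1
        ring

end LargeDeviations

theorem mainTheorem8 (d : ℕ) (hd : 1 ≤ d) (r : CoinIndex d → Fin d → ℤ)
    {Ω : Type*} [MeasurableSpace Ω] (ν : Measure Ω) [IsProbabilityMeasure ν]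
    (C : ℕ → Ω → Matrix (CoinIndex d) (CoinIndex d) ℂ)
    (π : ℕ → Ω → Equiv.Perm (CoinIndex d)) (Θ : ℕ → Ω → CoinIndex d → ℝ)
    (hC : ∀ k ω, C k ω = coinMatrix (π k ω) (Θ k ω))
    (hmeas : ∀ k, Measurable (C k))
    (hindep : iIndepFun C ν)
    (hident : ∀ k, IdentDistrib (C k) (C 0) ν ν)
    (hirr : (transitionMatrix ν (C 0)).IsIrreducible) :
    (∀ l : EuclideanSpace ℝ (Fin d),
      0 < perronEigenvalue (tiltedMatrix (transitionMatrix ν (C 0)) r l) ∧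
      IsGreatest (realEigenvalues (tiltedMatrix (transitionMatrix ν (C 0)) r l))
        (perronEigenvalue (tiltedMatrix (transitionMatrix ν (C 0)) r l))) ∧
    IsGoodRateFunction (rateFunction (transitionMatrix ν (C 0)) r) ∧
    IsConvexEReal (rateFunction (transitionMatrix ν (C 0)) r) ∧
    ∀ σ : CoinIndex d,
      LargeDeviationBounds ν (fun n ω => meanJump r (fun k => π k ω) σ n)
        (rateFunction (transitionMatrix ν (C 0)) r) := by
  have := coinIndex_nonempty hd
  -- As a measurable function of the coin, each `π k` inherits measurability, independence and
  -- identical distribution.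
  have hπC : ∀ k, π k = fun ω => supportPerm (C k ω) := fun k => by
    funext ω
    rw [hC, supportPerm_coinMatrix]
  have hπ : ∀ k, Measurable (π k) := fun k => by
    rw [hπC]
    exact measurable_supportPerm.comp (hmeas k)
  have hind : iIndepFun π ν := by
    rw [funext hπC]
    exact hindep.comp (fun _ => supportPerm) fun _ => measurable_supportPerm
  have hlaw : ∀ k κ τ, ν.real {ω | π k ω κ = τ} = transitionMatrix ν (C 0) κ τ := by
    intro k κ τ
    have hid : IdentDistrib (π k) (π 0) ν ν := by
      rw [hπC k, hπC 0]
      exact (hident k).comp measurable_supportPerm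
    rw [transitionMatrix_eq (hC 0) (hπ 0)]
    exact congrArg ENNReal.toReal
      (hid.measure_mem_eq (s := {p | p κ = τ}) MeasurableSet.of_discrete)
  have hP1 : ∀ κ, ∑ τ, transitionMatrix ν (C 0) κ τ = 1 := by
    intro κ
    have h := sum_measureReal_preimage_singleton (μ := ν) (f := fun ω => π 0 ω κ) Finset.univ
      fun τ _ => hπ 0 (MeasurableSet.of_discrete (s := {p : Equiv.Perm (CoinIndex d) | p κ = τ}))
    rw [Finset.coe_univ, Set.preimage_univ, probReal_univ] at h
    rw [← h]
    exact Finset.sum_congr rfl fun τ _ => (hlaw 0 κ τ).symm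
  have hpath := fun σ n τ v => measureReal_path_eq (r := r) hπ hind hlaw n σ τ v
  refine ⟨fun l => ?_, isGoodRateFunction_rateFunction hd hirr hP1, isConvexEReal_rateFunction,
    fun σ Γ => ⟨?_, liminf_le_limsup, limsup_le_neg_rateFunction hd hirr (hpath σ) Γ⟩⟩
  · have h := (tiltedMatrix_isIrreducible (r := r) hirr l).perronEigenvalue_spec
    exact ⟨h.1, h.2.1⟩
  · rw [EReal.neg_le]
    refine le_iInf₂ fun x hx => ?_
    rw [EReal.neg_le]
    exact neg_rateFunction_le_liminf hd hirr hP1 (hpath σ) hx
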